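/- Let $d\ge 1$ and $\alpha\in(1,2)$. Let $$c_{\alpha,d}=\frac{-\alpha(\alpha-1)\,\Gamma\left(\frac{\alpha+d}{2}\right)}{4\cos\left(\frac{\alpha\pi}{2}\right)\Gamma\left(\frac{\alpha+1}{2}\right)\pi^{(d-1)/2}\,\Gamma(2-\alpha)},\qquad \nu_\alpha(du)=c_{\alpha,d}\,\frac{du}{\|u\|^{d+\alpha}}\quad\text{on }\mathbb R^d,$$ and let $\mu_\alpha$ be the rotationally invariant $\alpha$-stable law on $\mathbb R^d$, that is, the probability measure with characteristic function $\xi\mapsto\exp(-\|\xi\|^\alpha/2)$. For a Borel probability measure $\mu$ on $\mathbb R^d$ and $X\sim\mu$, put $$\mathcal E_\mu(f)=\mathbb E\int_{\mathbb R^d}|f(X+u)-f(X)|^2\,\nu_\alpha(du),\qquad U_\alpha(\mu)=\sup_{f}\frac{\operatorname{Var}(f(X))}{\mathcal E_\mu(f)}\in[0,\infty],$$ where the supremum is over all Borel functions $f:\mathbb R^d\to\mathbb R$ with $\operatorname{Var}(f(X))<+\infty$ and $0<\mathcal E_\mu(f)<+\infty$. For $R>0$ and $1\le j\le d$ let $g_{R,j}(x)=x_j\exp(-\|x/R\|^2)$.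 Let $\mu$ be a centered probability measure on $\mathbb R^d$ with finite first moment such that, with $X\sim\mu$, for every $j\in\{1,\dots,d\}$, $$\lim_{R\to+\infty}\Bigl(\operatorname{Var}(g_{R,j}(X))-\mathcal E_\mu(g_{R,j})\Bigr)=0 .$$ If $U_\alpha(\mu)=1$, then $\mu=\mu_\alpha$; that is, $\mu$ has characteristic function $\exp(-\|\xi\|^\alpha/2)$, and it is the only probability measure with this characteristic function. -/

import Mathlib

open MeasureTheory ProbabilityTheory Filter Topology
open scoped ENNReal

noncomputable section

/-- The normalizing constant `c_{α,d}`. -/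
def stableConst (d : ℕ) (α : ℝ) : ℝ :=
  (-α * (α - 1) * Real.Gamma ((α + d) / 2)) /
    (4 * Real.cos (α * Real.pi / 2) * Real.Gamma ((α + 1) / 2) *
      Real.pi ^ (((d : ℝ) - 1) / 2) * Real.Gamma (2 - α))

/-- The Lévy measure `ν_α(du) = c_{α,d} ‖u‖^{-(d+α)} du` on `ℝᵈ`. In polar coordinates `u = r x`
it is `c_{α,d} r^{-(α+1)} dr σ(dx)` with `σ` the surface measure of the unit sphere. -/
def stableLevyMeasure (d : ℕ) (α : ℝ) : Measure (EuclideanSpace ℝ (Fin d)) :=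
  volume.withDensity fun u => ENNReal.ofReal (stableConst d α * ‖u‖ ^ (-((d : ℝ) + α)))

/-- The energy `E ∫ |f(X+u) - f(X)|² ν_α(du)` for `X ∼ μ`, as an extended nonnegative number. -/
def stableEnergy {d : ℕ} (α : ℝ) (μ : Measure (EuclideanSpace ℝ (Fin d)))
    (f : EuclideanSpace ℝ (Fin d) → ℝ) : ℝ≥0∞ :=
  ∫⁻ x, ∫⁻ u, ENNReal.ofReal (|f (x + u) - f x| ^ 2) ∂(stableLevyMeasure d α) ∂μ

/-- The class of test functions: `f : ℝᵈ → ℝ` Borel with `Var(f(X)) < ∞` and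
`0 < E ∫ |f(X+u) - f(X)|² ν_α(du) < ∞`, for `X ∼ μ`. -/
def stableTestFunctions {d : ℕ} (α : ℝ) (μ : Measure (EuclideanSpace ℝ (Fin d))) :
    Set (EuclideanSpace ℝ (Fin d) → ℝ) :=
  {f | Measurable f ∧ evariance f μ < ∞ ∧ 0 < stableEnergy α μ f ∧ stableEnergy α μ f < ∞}

/-- The Poincaré ratio functional `U_α(μ)`, with values in `[0, ∞]`. -/
def poincareU {d : ℕ} (α : ℝ) (μ : Measure (EuclideanSpace ℝ (Fin d))) : ℝ≥0∞ :=
  ⨆ f ∈ stableTestFunctions α μ, evariance f μ / stableEnergy α μ f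

/-- The smooth truncation `g_{R,j}(x) = x_j exp(-‖x/R‖²)` of the `j`-th coordinate. -/
def truncCoord {d : ℕ} (R : ℝ) (j : Fin d) (x : EuclideanSpace ℝ (Fin d)) : ℝ :=
  x j * Real.exp (-‖R⁻¹ • x‖ ^ 2)

/-- `μ` is the rotationally invariant `α`-stable law `μ_α`, i.e. the probability measure with
characteristic function `exp(-‖ξ‖^α / 2)`. -/
def IsRotInvStableLaw {d : ℕ} (α : ℝ) (μ : Measure (EuclideanSpace ℝ (Fin d))) : Prop :=
  IsProbabilityMeasure μ ∧
    ∀ ξ : EuclideanSpace ℝ (Fin d), charFun μ ξ = ((Real.exp (-(‖ξ‖ ^ α) / 2) : ℝ) : ℂ)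

end

/-! The bound `U_α(μ) ≤ 1` says that the symmetric form `D(f,g) = 𝓔(f,g) - Cov(f,g)` (`deficit`) is
positive semidefinite on bounded Lipschitz functions. Hence Cauchy–Schwarz holds for it: `D(g_R,h)²
≤ D(g_R,g_R) D(h,h)` (`deficit_sq_le`). The hypothesis on `g_R = g_{R,j}` is exactly `D(g_R,g_R) →
0`, so `D(g_R,h) → 0`. The truncations are Lipschitz uniformly in `R`, so dominated convergence
applies and, `μ` being centered, gives the Stein-type identity `E[X_j h(X)] = E ∫ u_j (h(X+u) -
h(X)) ν_α(du)` (`integral_coord_mul_eq`).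

Take `h` to be the cosine and sine of `⟨η, ·⟩`. The addition formulas separate `x` from `u`; the odd
part in `u` integrates to zero by symmetry, and the even part is the symbol `∫ ⟨η,u⟩ sin⟨η,u⟩
ν_α(du) = (α/2)‖η‖^α` (`integral_inner_mul_sin_stable`), whose constant is the reason for the choice
of `c_{α,d}`. Along each ray, `Φ(t) = E exp(i t⟨ξ,X⟩)` thus solves `t Φ'(t) = -(α/2) t^α ‖ξ‖^α
Φ(t)`, which forces `Φ(1) = exp(-‖ξ‖^α/2)`. Uniqueness is injectivity of the characteristic
function. -/

/-! ### The normalizing constant and the Lévy measure. -/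

theorem cos_mul_pi_div_two_neg {α : ℝ} (h1 : 1 < α) (h2 : α < 2) :
    Real.cos (α * Real.pi / 2) < 0 := by
  have := Real.pi_pos
  apply Real.cos_neg_of_pi_div_two_lt_of_lt <;> nlinarith

theorem stableConst_pos (d : ℕ) {α : ℝ} (h1 : 1 < α) (h2 : α < 2) : 0 < stableConst d α := by
  have hc := cos_mul_pi_div_two_neg h1 h2
  have g1 : 0 < Real.Gamma ((α + d) / 2) := Real.Gamma_pos_of_pos (by positivity)
  have g2 : 0 < Real.Gamma ((α + 1) / 2) := Real.Gamma_pos_of_pos (by positivity)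
  have g3 : 0 < Real.Gamma (2 - α) := Real.Gamma_pos_of_pos (by linarith)
  have g4 : 0 < Real.pi ^ (((d : ℝ) - 1) / 2) := Real.rpow_pos_of_pos Real.pi_pos _
  unfold stableConst
  apply div_pos_of_neg_of_neg
  · have : 0 < α * (α - 1) := mul_pos (by linarith) (by linarith)
    nlinarith [mul_pos this g1]
  · have := mul_pos (mul_pos g2 g4) g3
    nlinarith [mul_neg_of_neg_of_pos hc this]

/-- Value of the stable constant after the duplication and reflection formulas. -/
theorem stableConst_mul_eq (d : ℕ) {α : ℝ} (h1 : 1 < α) (h2 : α < 2) :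
    stableConst d α * (Real.pi ^ ((d : ℝ) / 2) * Real.Gamma (1 - α / 2) * 2 ^ (1 - α)) =
      α / 2 * Real.Gamma (((d : ℝ) + α) / 2) := by
  have hc := (cos_mul_pi_div_two_neg h1 h2).ne
  have g2 : 0 < Real.Gamma ((α + 1) / 2) := Real.Gamma_pos_of_pos (by positivity)
  have g3 : 0 < Real.Gamma (2 - α) := Real.Gamma_pos_of_pos (by linarith)
  have g4 : 0 < Real.pi ^ (((d : ℝ) - 1) / 2) := Real.rpow_pos_of_pos Real.pi_pos _
  have hpi : Real.pi ^ ((d : ℝ) / 2) = Real.pi ^ (((d : ℝ) - 1) / 2) * √Real.pi := by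
    rw [Real.sqrt_eq_rpow, ← Real.rpow_add Real.pi_pos]; ring_nf
  have hs : √Real.pi * √Real.pi = Real.pi := Real.mul_self_sqrt Real.pi_pos.le
  have hdup := Real.Gamma_mul_Gamma_add_half (1 - α / 2)
  have hrefl := Real.Gamma_mul_Gamma_one_sub ((α + 1) / 2)
  have hrec := Real.Gamma_add_one (s := (1 - α) / 2) (by intro h; linarith)
  have e1 : 1 - α / 2 + 1 / 2 = (1 - α) / 2 + 1 := by ring
  have e2 : 2 * (1 - α / 2) = 2 - α := by ring
  have e3 : 1 - (α + 1) / 2 = (1 - α) / 2 := by ring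
  have e4 : Real.pi * ((α + 1) / 2) = α * Real.pi / 2 + Real.pi / 2 := by ring
  have e5 : 1 - (2 - α) = -(1 - α) := by ring
  rw [e1, hrec, e2, e5, Real.rpow_neg (by norm_num)] at hdup
  rw [e3, e4, Real.sin_add_pi_div_two, eq_div_iff hc] at hrefl
  have h2p : (2 : ℝ) ^ (1 - α) ≠ 0 := (Real.rpow_pos_of_pos (by norm_num) _).ne'
  unfold stableConst
  rw [hpi, show (α + (d : ℝ)) / 2 = ((d : ℝ) + α) / 2 by ring]
  set G := Real.Gamma (((d : ℝ) + α) / 2)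
  set P := Real.pi ^ (((d : ℝ) - 1) / 2)
  set A := Real.Gamma (1 - α / 2)
  set B := Real.Gamma ((α + 1) / 2)
  set C := Real.Gamma (2 - α)
  set D := Real.Gamma ((1 - α) / 2)
  set T := (2 : ℝ) ^ (1 - α)
  set S := √Real.pi
  set k := Real.cos (α * Real.pi / 2)
  have hdup' : A * ((1 - α) / 2 * D) * T = C * S := by
    rw [hdup]; field_simp
  rw [div_mul_eq_mul_div, div_eq_iff (by positivity)]
  -- The two Gamma identities are linked through `D = Γ((1-α)/2)`, which neither side of the goal
  -- contains, so the goal is multiplied by it. It is nonzero because reflection makes `B * D * k`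
  -- equal to `π`.
  have hD : D ≠ 0 := by
    rintro h; rw [h] at hrefl; simp at hrefl; exact Real.pi_pos.ne hrefl
  apply mul_left_cancel₀ hD
  linear_combination (2 * α * G * P * S) * hdup' + 2 * α * G * P * C * hs - α * G * P * C * hrefl * 2

theorem measurable_stableDensity (d : ℕ) (α : ℝ) :
    Measurable fun u : EuclideanSpace ℝ (Fin d) =>
      ENNReal.ofReal (stableConst d α * ‖u‖ ^ (-((d : ℝ) + α))) := by
  fun_prop

theorem toReal_stableDensity (d : ℕ) {α : ℝ} (h1 : 1 < α) (h2 : α < 2)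
    (u : EuclideanSpace ℝ (Fin d)) :
    (ENNReal.ofReal (stableConst d α * ‖u‖ ^ (-((d : ℝ) + α)))).toReal =
      stableConst d α * ‖u‖ ^ (-((d : ℝ) + α)) :=
  ENNReal.toReal_ofReal (mul_nonneg (stableConst_pos d h1 h2).le (by positivity))

theorem integrable_stableLevyMeasure_iff {d : ℕ} {α : ℝ} (h1 : 1 < α) (h2 : α < 2)
    {g : EuclideanSpace ℝ (Fin d) → ℝ} :
    Integrable g (stableLevyMeasure d α) ↔
      Integrable (fun u => ‖u‖ ^ (-((d : ℝ) + α)) * g u) := by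
  unfold stableLevyMeasure
  rw [integrable_withDensity_iff_integrable_smul' (measurable_stableDensity d α)
    (ae_of_all _ fun _ => ENNReal.ofReal_lt_top)]
  simp_rw [toReal_stableDensity d h1 h2, smul_eq_mul, mul_assoc]
  exact integrable_const_mul_iff (isUnit_iff_ne_zero.2 (stableConst_pos d h1 h2).ne') _

theorem integral_stableLevyMeasure {d : ℕ} {α : ℝ} (h1 : 1 < α) (h2 : α < 2)
    (g : EuclideanSpace ℝ (Fin d) → ℝ) :
    ∫ u, g u ∂(stableLevyMeasure d α) =
      stableConst d α * ∫ u, ‖u‖ ^ (-((d : ℝ) + α)) * g u := by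
  unfold stableLevyMeasure
  rw [integral_withDensity_eq_integral_toReal_smul (measurable_stableDensity d α)
    (ae_of_all _ fun _ => ENNReal.ofReal_lt_top)]
  simp_rw [toReal_stableDensity d h1 h2, smul_eq_mul, mul_assoc]
  exact integral_const_mul _ _

instance (d : ℕ) (α : ℝ) : SFinite (stableLevyMeasure d α) := by
  unfold stableLevyMeasure; infer_instance

instance (d : ℕ) (α : ℝ) : (stableLevyMeasure d α).IsNegInvariant := by
  constructor
  unfold stableLevyMeasure
  ext s hs
  rw [Measure.neg_apply, withDensity_apply _ hs, withDensity_apply _ hs.neg]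
  rw [← lintegral_indicator hs, ← lintegral_indicator hs.neg, ← lintegral_neg_eq_self]
  refine lintegral_congr fun u => ?_
  by_cases hu : u ∈ s
  · rw [Set.indicator_of_mem (by simpa using hu), Set.indicator_of_mem hu, norm_neg]
  · rw [Set.indicator_of_notMem (by simpa using hu), Set.indicator_of_notMem hu]

/-- The weight `‖u‖ (1 ∧ ‖u‖)` is integrable for the stable Lévy measure. -/
theorem integrable_stable_weight {d : ℕ} (hd : 1 ≤ d) {α : ℝ} (h1 : 1 < α) (h2 : α < 2) :
    Integrable (fun u : EuclideanSpace ℝ (Fin d) => ‖u‖ * min 1 ‖u‖) (stableLevyMeasure d α) := by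
  have : Nonempty (Fin d) := ⟨⟨0, hd⟩⟩
  rw [integrable_stableLevyMeasure_iff h1 h2,
    integrable_fun_norm_addHaar (volume : Measure (EuclideanSpace ℝ (Fin d)))
      (f := fun r => r ^ (-((d : ℝ) + α)) * (r * min 1 r)), finrank_euclideanSpace_fin]
  -- In polar coordinates the integrand is `r^(1-α)` near `0` and `r^(-α)` at infinity: `α < 2`
  -- gives integrability at the origin and `α > 1` at infinity.
  have key : ∀ r ∈ Set.Ioi (0 : ℝ),
      r ^ (d - 1) • (r ^ (-((d : ℝ) + α)) * (r * min 1 r)) = r ^ (-α) * min 1 r := by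
    intro r hr
    have hr : 0 < r := hr
    rw [smul_eq_mul, ← Real.rpow_natCast, Nat.cast_sub hd, ← mul_assoc, ← mul_assoc,
      ← Real.rpow_add hr, ← Real.rpow_add_one hr.ne']
    congr 2; push_cast; ring
  rw [integrableOn_congr_fun key measurableSet_Ioi, ← Set.Ioc_union_Ioi_eq_Ioi zero_le_one]
  refine IntegrableOn.union ?_ ?_
  · have := (intervalIntegral.intervalIntegrable_rpow' (a := 0) (b := 1) (r := 1 - α)
      (by linarith)).1
    refine this.congr_fun (fun r hr => ?_) measurableSet_Ioc
    simp only
    rw [min_eq_right hr.2, ← Real.rpow_add_one hr.1.ne']; ring_nf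
  · refine (integrableOn_Ioi_rpow_of_lt (a := -α) (by linarith) one_pos).congr_fun
      (fun r hr => ?_) measurableSet_Ioi
    simp only
    rw [min_eq_left (le_of_lt hr), mul_one]

/-! ### Differentiation of Fourier integrals and Gaussian moments. -/

/-- Serves twice: with a Gaussian weight for the symbol, and with `w = 1` for the characteristic
function of `μ` along a ray. -/
theorem hasDerivAt_integral_exp_inner {E : Type*} [NormedAddCommGroup E] [InnerProductSpace ℝ E]
    [MeasurableSpace E] [BorelSpace E] [SecondCountableTopology E] {μ : Measure E} {w : E → ℂ}
    (hw : Integrable w μ) (hw' : Integrable (fun x => ‖x‖ * ‖w x‖) μ) (ξ : E) (t : ℝ) :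
    HasDerivAt (fun t : ℝ => ∫ x, w x * Complex.exp ((t * inner ℝ ξ x : ℝ) * Complex.I) ∂μ)
      (∫ x, w x * (Complex.exp ((t * inner ℝ ξ x : ℝ) * Complex.I) *
        ((inner ℝ ξ x : ℝ) * Complex.I)) ∂μ) t := by
  have hm : ∀ t : ℝ, Continuous fun x : E =>
      Complex.exp ((t * inner ℝ ξ x : ℝ) * Complex.I) := by intro t; fun_prop
  have hi : Continuous fun x : E => ((inner ℝ ξ x : ℝ) : ℂ) * Complex.I := by fun_prop
  refine (hasDerivAt_integral_of_dominated_loc_of_deriv_le (s := Set.univ) Filter.univ_mem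
    (bound := fun x => ‖ξ‖ * (‖x‖ * ‖w x‖))
    (F' := fun t x => w x * (Complex.exp ((t * inner ℝ ξ x : ℝ) * Complex.I) *
        ((inner ℝ ξ x : ℝ) * Complex.I)))
    (Eventually.of_forall fun t => hw.1.mul (hm t).aestronglyMeasurable) ?_
    (hw.1.mul ((hm t).mul hi).aestronglyMeasurable) ?_ (hw'.const_mul _) ?_).2
  · refine hw.mono (hw.1.mul (hm t).aestronglyMeasurable) (ae_of_all _ fun x => ?_)
    rw [Pi.mul_apply, norm_mul, Complex.norm_exp_ofReal_mul_I, mul_one]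
  · refine ae_of_all _ fun x t _ => ?_
    rw [norm_mul, norm_mul, norm_mul, Complex.norm_exp_ofReal_mul_I, Complex.norm_I, mul_one,
      one_mul, Complex.norm_real]
    have := norm_inner_le_norm (𝕜 := ℝ) ξ x
    have := mul_le_mul_of_nonneg_left this (norm_nonneg (w x))
    linarith
  · refine ae_of_all _ fun x t _ => ?_
    refine HasDerivAt.const_mul _ (HasDerivAt.cexp ?_)
    refine HasDerivAt.mul_const ?_ _
    simpa using (hasDerivAt_id t).mul_const (inner ℝ ξ x) |>.ofReal_comp

section gaussian

variable {E : Type*} [NormedAddCommGroup E] [InnerProductSpace ℝ E] [FiniteDimensional ℝ E]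
  [MeasurableSpace E] [BorelSpace E]

theorem integrable_exp_neg_mul_sq_norm {s : ℝ} (hs : 0 < s) :
    Integrable fun u : E => Real.exp (-s * ‖u‖ ^ 2) := by
  have := (GaussianFourier.integrable_cexp_neg_mul_sq_norm_add (V := E) (b := s)
    (by simpa using hs) 0 0).norm
  refine this.congr (ae_of_all _ fun u => ?_)
  simp only [Complex.norm_exp]
  congr 1
  simp [← Complex.ofReal_pow]

theorem integrable_norm_mul_exp_neg_mul_sq_norm {s : ℝ} (hs : 0 < s) :
    Integrable fun u : E => ‖u‖ * Real.exp (-s * ‖u‖ ^ 2) := by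
  refine ((integrable_exp_neg_mul_sq_norm (E := E) (half_pos hs)).const_mul (1 + 2 / s)).mono'
    (by fun_prop) (ae_of_all _ fun u => ?_)
  rw [Real.norm_of_nonneg (by positivity)]
  -- Half of the exponent absorbs the factor `‖u‖`. The constant `1 + 2 / s` is chosen so that its
  -- product with `1 + s/2 ‖u‖²` contains `1 + ‖u‖²`, which dominates `‖u‖`.
  have e : Real.exp (-s * ‖u‖ ^ 2) =
      Real.exp (-(s / 2 * ‖u‖ ^ 2)) * Real.exp (-(s / 2) * ‖u‖ ^ 2) := by
    rw [← Real.exp_add]; ring_nf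
  rw [e, ← mul_assoc]
  refine mul_le_mul_of_nonneg_right ?_ (Real.exp_pos _).le
  rw [Real.exp_neg, ← div_eq_mul_inv, div_le_iff₀ (Real.exp_pos _)]
  have h3 := Real.add_one_le_exp (s / 2 * ‖u‖ ^ 2)
  refine le_trans ?_ (mul_le_mul_of_nonneg_left h3 (by positivity))
  have : (1 + 2 / s) * (s / 2 * ‖u‖ ^ 2 + 1) =
      1 + ‖u‖ ^ 2 + 2 / s + s / 2 * ‖u‖ ^ 2 := by field_simp; ring
  rw [this]
  have : 0 < 2 / s := by positivity
  have : 0 ≤ s / 2 * ‖u‖ ^ 2 := by positivity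
  nlinarith [sq_nonneg (‖u‖ - 1 / 2)]

/-- First-order Gaussian Fourier moment. -/
theorem integral_inner_mul_sin_mul_gaussian {s : ℝ} (hs : 0 < s) (ξ : E) :
    ∫ u : E, Real.exp (-s * ‖u‖ ^ 2) * (inner ℝ ξ u * Real.sin (inner ℝ ξ u)) =
      (Real.pi / s) ^ ((Module.finrank ℝ E : ℝ) / 2) *
        (‖ξ‖ ^ 2 / (2 * s) * Real.exp (-(‖ξ‖ ^ 2 / (4 * s)))) := by
  have hw : Integrable fun u : E => ((Real.exp (-s * ‖u‖ ^ 2) : ℝ) : ℂ) :=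
    (integrable_exp_neg_mul_sq_norm hs).ofReal
  have hw' : Integrable fun u : E => ‖u‖ * ‖((Real.exp (-s * ‖u‖ ^ 2) : ℝ) : ℂ)‖ := by
    simpa [abs_of_pos, Real.exp_pos, Complex.norm_exp, ← Complex.ofReal_pow] using
      integrable_norm_mul_exp_neg_mul_sq_norm (E := E) hs
  -- The moment is minus the real part of the derivative at `t = 1` of the Gaussian Fourier
  -- transform at `t • ξ`, which is known in closed form.
  have hd := hasDerivAt_integral_exp_inner hw hw' ξ 1
  have hval : ∀ t : ℝ, ∫ u : E, ((Real.exp (-s * ‖u‖ ^ 2) : ℝ) : ℂ) *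
      Complex.exp ((t * inner ℝ ξ u : ℝ) * Complex.I) =
      (((Real.pi / s) ^ ((Module.finrank ℝ E : ℝ) / 2) *
        Real.exp (-(‖ξ‖ ^ 2 / (4 * s)) * t ^ 2) : ℝ) : ℂ) := by
    intro t
    have := GaussianFourier.integral_cexp_neg_mul_sq_norm_add (V := E) (b := s)
      (by simpa using hs) (t * Complex.I) ξ
    rw [Complex.ofReal_mul, Complex.ofReal_cpow (by positivity)]
    push_cast
    convert this using 2
    · ext u
      rw [← Complex.exp_add]
      congr 1; ring
    · congr 1
      rw [mul_pow, Complex.I_sq]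
      ring
  simp_rw [hval] at hd
  have hd2 : HasDerivAt (fun t : ℝ => (Real.pi / s) ^ ((Module.finrank ℝ E : ℝ) / 2) *
        Real.exp (-(‖ξ‖ ^ 2 / (4 * s)) * t ^ 2)) ((Real.pi / s) ^ ((Module.finrank ℝ E : ℝ) / 2) *
        (Real.exp (-(‖ξ‖ ^ 2 / (4 * s)) * 1 ^ 2) * (-(‖ξ‖ ^ 2 / (4 * s)) * (2 * 1)))) 1 := by
    refine HasDerivAt.const_mul _ (HasDerivAt.exp (HasDerivAt.const_mul _ ?_))
    simpa using hasDerivAt_pow 2 (1 : ℝ)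
  have hu := hd.unique hd2.ofReal_comp
  have hI : Integrable fun u : E => ((Real.exp (-s * ‖u‖ ^ 2) : ℝ) : ℂ) *
      (Complex.exp (((1 : ℝ) * inner ℝ ξ u : ℝ) * Complex.I) *
        ((inner ℝ ξ u : ℝ) * Complex.I)) := by
    refine (hw'.const_mul ‖ξ‖).mono' (by fun_prop) (ae_of_all _ fun u => ?_)
    rw [norm_mul, norm_mul, norm_mul, Complex.norm_exp_ofReal_mul_I, Complex.norm_I, mul_one,
      one_mul, Complex.norm_real (inner ℝ ξ u)]
    have := norm_inner_le_norm (𝕜 := ℝ) ξ u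
    have := mul_le_mul_of_nonneg_left this
      (norm_nonneg ((Real.exp (-s * ‖u‖ ^ 2) : ℝ) : ℂ))
    linarith
  have hre := congrArg Complex.re hu
  rw [Complex.ofReal_re, ← RCLike.re_eq_complex_re, ← integral_re hI] at hre
  have : ∀ u : E, RCLike.re (((Real.exp (-s * ‖u‖ ^ 2) : ℝ) : ℂ) *
      (Complex.exp (((1 : ℝ) * inner ℝ ξ u : ℝ) * Complex.I) *
        ((inner ℝ ξ u : ℝ) * Complex.I))) =
      -(Real.exp (-s * ‖u‖ ^ 2) * (inner ℝ ξ u * Real.sin (inner ℝ ξ u))) := by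
    intro u
    rw [RCLike.re_eq_complex_re, Complex.re_ofReal_mul, one_mul, Complex.mul_re,
      Complex.exp_ofReal_mul_I_re, Complex.exp_ofReal_mul_I_im, Complex.re_ofReal_mul,
      Complex.im_ofReal_mul, Complex.I_re, Complex.I_im]
    ring
  simp_rw [this] at hre
  rw [integral_neg] at hre
  rw [← neg_inj, hre]
  simp only [one_pow, mul_one]
  ring

end gaussian

/-! ### The symbol of the Lévy measure. -/

theorem min_one_mul_le {a b : ℝ} (ha : 0 ≤ a) (hb : 0 ≤ b) :
    min 1 (a * b) ≤ (1 + a) * min 1 b := by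
  rcases le_total 1 b with h | h
  · rw [min_eq_left h]
    exact (min_le_left _ _).trans (by linarith)
  · rw [min_eq_right h]
    exact (min_le_right _ _).trans (by nlinarith)

theorem abs_sin_le_min (y : ℝ) : |Real.sin y| ≤ min 1 |y| :=
  le_min (Real.abs_sin_le_one y) (by simpa using Real.abs_sin_sub_sin_le y 0)

theorem integrable_stable_of_bound {d : ℕ} (hd : 1 ≤ d) {α : ℝ} (h1 : 1 < α) (h2 : α < 2)
    {f : EuclideanSpace ℝ (Fin d) → ℝ} (hf : Measurable f) {C : ℝ}
    (hC : ∀ u, |f u| ≤ C * (‖u‖ * min 1 ‖u‖)) : Integrable f (stableLevyMeasure d α) :=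
  ((integrable_stable_weight hd h1 h2).const_mul C).mono' hf.aestronglyMeasurable
    (ae_of_all _ hC)

theorem integrable_inner_mul_sin_stable {d : ℕ} (hd : 1 ≤ d) {α : ℝ} (h1 : 1 < α) (h2 : α < 2)
    (ξ : EuclideanSpace ℝ (Fin d)) :
    Integrable (fun u => inner ℝ ξ u * Real.sin (inner ℝ ξ u)) (stableLevyMeasure d α) := by
  refine integrable_stable_of_bound hd h1 h2 (C := ‖ξ‖ * (1 + ‖ξ‖)) (by fun_prop) fun u => ?_
  have hb : |inner ℝ ξ u| ≤ ‖ξ‖ * ‖u‖ := norm_inner_le_norm (𝕜 := ℝ) ξ u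
  rw [abs_mul]
  calc |inner ℝ ξ u| * |Real.sin (inner ℝ ξ u)|
      ≤ (‖ξ‖ * ‖u‖) * ((1 + ‖ξ‖) * min 1 ‖u‖) := by
        refine mul_le_mul hb ?_ (abs_nonneg _) (by positivity)
        exact (abs_sin_le_min _).trans ((min_le_min_left 1 hb).trans
          (min_one_mul_le (norm_nonneg _) (norm_nonneg _)))
    _ = _ := by ring

/-- The substitution `s ↦ 1/s` turns this into a Gamma integral. -/
theorem integral_Ioi_rpow_mul_exp_neg_div {p A : ℝ} (hp : p < -1) (hA : 0 < A) :
    ∫ s in Set.Ioi (0 : ℝ), s ^ p * Real.exp (-(A / s)) =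
      (1 / A) ^ (-p - 1) * Real.Gamma (-p - 1) := by
  rw [← Real.integral_rpow_mul_exp_neg_mul_Ioi (by linarith) hA,
    ← integral_comp_rpow_Ioi _ (show (-1 : ℝ) ≠ 0 by norm_num)]
  refine setIntegral_congr_fun measurableSet_Ioi fun s hs => ?_
  have hs : 0 < s := hs
  simp only [smul_eq_mul]
  rw [← Real.rpow_mul hs.le, ← mul_assoc, abs_neg, abs_one, one_mul, ← Real.rpow_add hs,
    Real.rpow_neg_one, div_inv_eq_mul]
  congr 2; ring

/-- The symbol of the stable Lévy measure. -/
theorem integral_inner_mul_sin_stable {d : ℕ} (hd : 1 ≤ d) {α : ℝ} (h1 : 1 < α) (h2 : α < 2)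
    (ξ : EuclideanSpace ℝ (Fin d)) :
    ∫ u, inner ℝ ξ u * Real.sin (inner ℝ ξ u) ∂(stableLevyMeasure d α) =
      α / 2 * ‖ξ‖ ^ α := by
  rcases eq_or_ne ξ 0 with rfl | hξ
  · simp [Real.zero_rpow (by linarith : α ≠ 0)]
  have hξ' : 0 < ‖ξ‖ := norm_pos_iff.2 hξ
  set q : ℝ := ((d : ℝ) + α) / 2 with hq
  have hq0 : 0 < q := by positivity
  set g : EuclideanSpace ℝ (Fin d) → ℝ := fun u => inner ℝ ξ u * Real.sin (inner ℝ ξ u) with hg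
  have hg0 : g 0 = 0 := by simp [hg]
  have hgm : Measurable g := by fun_prop
  have hgi : Integrable fun u => ‖u‖ ^ (-((d : ℝ) + α)) * g u :=
    (integrable_stableLevyMeasure_iff h1 h2).1 (integrable_inner_mul_sin_stable hd h1 h2 ξ)
  have hG : 0 < Real.Gamma q := Real.Gamma_pos_of_pos hq0
  -- Subordination: the power `‖u‖^(-(d+α))` is a mixture of Gaussians `exp(-s‖u‖²)`. Exchanging the
  -- order of integration reduces the symbol to the Gaussian moment.
  have hpow : ∀ u : EuclideanSpace ℝ (Fin d), u ≠ 0 →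
      ∫ s in Set.Ioi (0 : ℝ), s ^ (q - 1) * Real.exp (-(‖u‖ ^ 2 * s)) =
        ‖u‖ ^ (-((d : ℝ) + α)) * Real.Gamma q := by
    intro u hu
    have hu' : 0 < ‖u‖ := norm_pos_iff.2 hu
    rw [Real.integral_rpow_mul_exp_neg_mul_Ioi hq0 (by positivity), one_div,
      Real.inv_rpow (by positivity), ← Real.rpow_natCast, ← Real.rpow_mul hu'.le,
      ← Real.rpow_neg hu'.le]
    congr 2; rw [hq]; push_cast; ring
  have hin : ∀ u, ∫ s in Set.Ioi (0 : ℝ), g u * (s ^ (q - 1) * Real.exp (-(‖u‖ ^ 2 * s))) =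
      Real.Gamma q * (‖u‖ ^ (-((d : ℝ) + α)) * g u) := by
    intro u
    rcases eq_or_ne u 0 with rfl | hu
    · simp [hg0]
    · rw [integral_const_mul, hpow u hu]; ring
  have hF : Integrable (Function.uncurry fun (u : EuclideanSpace ℝ (Fin d)) (s : ℝ) =>
      g u * (s ^ (q - 1) * Real.exp (-(‖u‖ ^ 2 * s))))
      (volume.prod (volume.restrict (Set.Ioi 0))) := by
    rw [integrable_prod_iff (by
      refine Measurable.aestronglyMeasurable ?_
      unfold Function.uncurry
      fun_prop)]
    constructor
    · refine ae_of_all _ fun u => ?_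
      simp only [Function.uncurry]
      rcases eq_or_ne u 0 with rfl | hu
      · simp [hg0]
      · refine Integrable.const_mul ?_ _
        -- A non-integrable function has integral `0` by convention, whereas `hpow` gives a positive
        -- value.
        by_contra h
        have h' := hpow u hu
        rw [integral_undef h] at h'
        have : 0 < ‖u‖ := norm_pos_iff.2 hu
        exact (mul_pos (Real.rpow_pos_of_pos this _) hG).ne h'
    · refine (hgi.norm.const_mul (Real.Gamma q)).congr (ae_of_all _ fun u => ?_)
      simp only [Function.uncurry]
      have : ∫ s in Set.Ioi (0 : ℝ), ‖g u * (s ^ (q - 1) * Real.exp (-(‖u‖ ^ 2 * s)))‖ =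
          ∫ s in Set.Ioi (0 : ℝ), ‖g u‖ * (s ^ (q - 1) * Real.exp (-(‖u‖ ^ 2 * s))) := by
        refine setIntegral_congr_fun measurableSet_Ioi fun s hs => ?_
        have hs : 0 < s := hs
        rw [norm_mul, Real.norm_of_nonneg (r := s ^ (q - 1) * _) (by positivity)]
      rw [this]
      rcases eq_or_ne u 0 with rfl | hu
      · simp [hg0]
      · rw [integral_const_mul, hpow u hu, norm_mul, Real.norm_of_nonneg (by positivity)]; ring
  have hswap := integral_integral_swap hF
  simp_rw [hin] at hswap
  rw [integral_const_mul] at hswap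
  have hout : ∫ s in Set.Ioi (0 : ℝ), ∫ u : EuclideanSpace ℝ (Fin d),
      g u * (s ^ (q - 1) * Real.exp (-(‖u‖ ^ 2 * s))) =
      ∫ s in Set.Ioi (0 : ℝ), Real.pi ^ ((d : ℝ) / 2) * ‖ξ‖ ^ 2 / 2 *
        (s ^ (α / 2 - 2) * Real.exp (-((‖ξ‖ ^ 2 / 4) / s))) := by
    refine setIntegral_congr_fun measurableSet_Ioi fun s hs => ?_
    have hs : 0 < s := hs
    have e : ∀ u : EuclideanSpace ℝ (Fin d), g u * (s ^ (q - 1) * Real.exp (-(‖u‖ ^ 2 * s))) =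
        s ^ (q - 1) * (Real.exp (-s * ‖u‖ ^ 2) * g u) := by
      intro u; rw [show -(‖u‖ ^ 2 * s) = -s * ‖u‖ ^ 2 by ring]; ring
    simp only [e]
    rw [integral_const_mul, integral_inner_mul_sin_mul_gaussian hs ξ, finrank_euclideanSpace_fin,
      Real.div_rpow Real.pi_pos.le hs.le, div_div (‖ξ‖ ^ 2) 4 s]
    have e2 : s ^ (q - 1) = s ^ (α / 2 - 2) * s ^ ((d : ℝ) / 2) * s := by
      rw [← Real.rpow_add hs, ← Real.rpow_add_one hs.ne']; congr 1; rw [hq]; ring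
    have : s ^ ((d : ℝ) / 2) ≠ 0 := (Real.rpow_pos_of_pos hs _).ne'
    rw [e2]
    field_simp
  rw [hout, integral_const_mul, integral_Ioi_rpow_mul_exp_neg_div (by linarith) (by positivity)]
    at hswap
  rw [integral_stableLevyMeasure h1 h2]
  have hc := stableConst_mul_eq d h1 h2
  have e3 : (1 / (‖ξ‖ ^ 2 / 4)) ^ (-(α / 2 - 2) - 1) = 2 ^ (2 - α) * ‖ξ‖ ^ (α - 2) := by
    have : (1 / (‖ξ‖ ^ 2 / 4)) = (2 / ‖ξ‖) ^ (2 : ℝ) := by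
      rw [Real.rpow_two]; field_simp; norm_num
    rw [this, ← Real.rpow_mul (by positivity), Real.div_rpow (by norm_num) hξ'.le, div_eq_mul_inv,
      ← Real.rpow_neg hξ'.le]
    congr 2 <;> ring
  have e4 : -(α / 2 - 2) - 1 = 1 - α / 2 := by ring
  have e5 : (2 : ℝ) ^ (2 - α) = 2 ^ (1 - α) * 2 := by
    rw [← Real.rpow_add_one (by norm_num)]; ring_nf
  have e6 : ‖ξ‖ ^ α = ‖ξ‖ ^ (α - 2) * ‖ξ‖ ^ 2 := by
    rw [← Real.rpow_two, ← Real.rpow_add hξ']; ring_nf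
  rw [e3, e4, e5] at hswap
  rw [e6]
  apply mul_left_cancel₀ hG.ne'
  rw [← hq] at hc
  linear_combination stableConst d α * hswap + ‖ξ‖ ^ (α - 2) * ‖ξ‖ ^ 2 * hc

/-! ### Truncated coordinates: bounds uniform in `R`. -/

theorem mul_exp_neg_sq_le_one {p : ℝ} : p * Real.exp (-p ^ 2) ≤ 1 := by
  rw [Real.exp_neg, ← div_eq_mul_inv, div_le_one (Real.exp_pos _)]
  nlinarith [Real.add_one_le_exp (p ^ 2), sq_nonneg (p - 1 / 2)]

/-- For `q - p ≥ 1` the left side is at most `1`. Otherwise `1 - e^(-y) ≤ y` together with `q² - p²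
= (q-p)(2p + (q-p))` gives the constant `2 + 1`. -/
theorem mul_exp_neg_sq_sub_le {p q : ℝ} (hp : 0 ≤ p) (hpq : p ≤ q) :
    p * (Real.exp (-p ^ 2) - Real.exp (-q ^ 2)) ≤ 3 * (q - p) := by
  have h1 := mul_exp_neg_sq_le_one (p := p)
  rcases le_total 1 (q - p) with h | h
  · nlinarith [mul_nonneg hp (Real.exp_pos (-q ^ 2)).le]
  have h2 : p ^ 2 * Real.exp (-p ^ 2) ≤ 1 := by
    rw [Real.exp_neg, ← div_eq_mul_inv, div_le_one (Real.exp_pos _)]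
    linarith [Real.add_one_le_exp (p ^ 2)]
  have h3 : Real.exp (-p ^ 2) - Real.exp (-q ^ 2) ≤
      Real.exp (-p ^ 2) * (q ^ 2 - p ^ 2) := by
    have e : Real.exp (-q ^ 2) = Real.exp (-p ^ 2) * Real.exp (-(q ^ 2 - p ^ 2)) := by
      rw [← Real.exp_add]; ring_nf
    rw [e]
    nlinarith [Real.add_one_le_exp (-(q ^ 2 - p ^ 2)), Real.exp_pos (-p ^ 2)]
  have h4 := mul_le_mul_of_nonneg_left h3 hp
  have hd : 0 ≤ q - p := by linarith
  have e : p * (Real.exp (-p ^ 2) * (q ^ 2 - p ^ 2)) =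
      (q - p) * (2 * (p ^ 2 * Real.exp (-p ^ 2)) + (q - p) * (p * Real.exp (-p ^ 2))) := by ring
  rw [e] at h4
  refine h4.trans ?_
  have h5 : (q - p) * (p * Real.exp (-p ^ 2)) ≤ 1 := by
    have : 0 ≤ p * Real.exp (-p ^ 2) := by positivity
    nlinarith
  nlinarith

section truncCoord

variable {d : ℕ}

theorem continuous_truncCoord (R : ℝ) (j : Fin d) : Continuous (truncCoord R j) := by
  unfold truncCoord; fun_prop

theorem abs_coord_le_norm (x : EuclideanSpace ℝ (Fin d)) (j : Fin d) : |x j| ≤ ‖x‖ :=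
  PiLp.norm_apply_le x j

theorem abs_truncCoord_le_norm (R : ℝ) (j : Fin d) (x : EuclideanSpace ℝ (Fin d)) :
    |truncCoord R j x| ≤ ‖x‖ := by
  unfold truncCoord
  rw [abs_mul, Real.abs_exp]
  have : Real.exp (-‖R⁻¹ • x‖ ^ 2) ≤ 1 := Real.exp_le_one_iff.2 (by simp)
  nlinarith [abs_coord_le_norm x j, abs_nonneg (x j), norm_nonneg x]

theorem norm_eq_mul_norm_inv_smul {R : ℝ} (hR : 0 < R) (x : EuclideanSpace ℝ (Fin d)) :
    ‖x‖ = R * ‖R⁻¹ • x‖ := by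
  rw [norm_smul, norm_inv, Real.norm_of_nonneg hR.le]; field_simp

theorem abs_truncCoord_le {R : ℝ} (hR : 0 < R) (j : Fin d) (x : EuclideanSpace ℝ (Fin d)) :
    |truncCoord R j x| ≤ R := by
  unfold truncCoord
  rw [abs_mul, Real.abs_exp]
  calc |x j| * Real.exp (-‖R⁻¹ • x‖ ^ 2)
      ≤ (R * ‖R⁻¹ • x‖) * Real.exp (-‖R⁻¹ • x‖ ^ 2) := by
        gcongr
        exact (abs_coord_le_norm x j).trans_eq (norm_eq_mul_norm_inv_smul hR x)
    _ = R * (‖R⁻¹ • x‖ * Real.exp (-‖R⁻¹ • x‖ ^ 2)) := by ring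
    _ ≤ R := by
      have := mul_le_mul_of_nonneg_left (mul_exp_neg_sq_le_one (p := ‖R⁻¹ • x‖)) hR.le
      simpa using this

/-- The independence of the constant from `R` is what allows dominated convergence as `R → ∞`.
Varying the coordinate costs `1`, and varying the exponential factor, at the point of smaller norm,
costs `3`. -/
theorem abs_truncCoord_sub_le {R : ℝ} (hR : 0 < R) (j : Fin d)
    (x y : EuclideanSpace ℝ (Fin d)) :
    |truncCoord R j y - truncCoord R j x| ≤ 4 * ‖y - x‖ := by
  wlog h : ‖x‖ ≤ ‖y‖ generalizing x y
  · rw [abs_sub_comm, norm_sub_rev]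
    exact this y x (le_of_not_ge h)
  have hp : ‖R⁻¹ • x‖ ≤ ‖R⁻¹ • y‖ := by
    rw [norm_smul, norm_smul]; gcongr
  unfold truncCoord
  set a := Real.exp (-‖R⁻¹ • x‖ ^ 2)
  set b := Real.exp (-‖R⁻¹ • y‖ ^ 2)
  have hab : b ≤ a := Real.exp_le_exp.2 (by gcongr)
  have hb1 : b ≤ 1 := Real.exp_le_one_iff.2 (by simp)
  have hb0 : 0 < b := Real.exp_pos _
  have hxy : |y j - x j| ≤ ‖y - x‖ := abs_coord_le_norm (y - x) j
  have key := mul_le_mul_of_nonneg_left (mul_exp_neg_sq_sub_le (norm_nonneg (R⁻¹ • x)) hp) hR.le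
  have e : R * (3 * (‖R⁻¹ • y‖ - ‖R⁻¹ • x‖)) = 3 * (‖y‖ - ‖x‖) := by
    rw [norm_eq_mul_norm_inv_smul hR x, norm_eq_mul_norm_inv_smul hR y]; ring
  rw [e, ← mul_assoc, ← norm_eq_mul_norm_inv_smul hR x] at key
  have hn := norm_sub_norm_le y x
  calc |y j * b - x j * a| = |(y j - x j) * b + x j * (b - a)| := by ring_nf
    _ ≤ |(y j - x j) * b| + |x j * (b - a)| := abs_add_le _ _
    _ = |y j - x j| * b + |x j| * (a - b) := by
      rw [abs_mul, abs_mul, abs_of_pos hb0, abs_of_nonpos (sub_nonpos.2 hab), neg_sub]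
    _ ≤ ‖y - x‖ + ‖x‖ * (a - b) := by
      refine add_le_add ?_ (mul_le_mul_of_nonneg_right (abs_coord_le_norm x j) (by linarith))
      nlinarith [abs_nonneg (y j - x j)]
    _ ≤ 4 * ‖y - x‖ := by linarith

theorem tendsto_truncCoord (j : Fin d) (x : EuclideanSpace ℝ (Fin d)) :
    Tendsto (fun R : ℝ => truncCoord R j x) atTop (𝓝 (x j)) := by
  have h : Continuous fun r : ℝ => x j * Real.exp (-‖r • x‖ ^ 2) := by fun_prop
  have := (h.tendsto 0).comp tendsto_inv_atTop_zero
  simpa [truncCoord, Function.comp_def] using this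

end truncCoord

/-! ### The class of bounded Lipschitz functions. -/

/-- Continuous functions bounded by `C` whose increments are at most `C (1 ∧ ‖u‖)`. -/
structure IsBddLip {E : Type*} [NormedAddCommGroup E] (f : E → ℝ) (C : ℝ) : Prop where
  cont : Continuous f
  bdd : ∀ x, |f x| ≤ C
  incr : ∀ x u, |f (x + u) - f x| ≤ C * min 1 ‖u‖

namespace IsBddLip

variable {E : Type*} [NormedAddCommGroup E]

theorem nonneg {f : E → ℝ} {C : ℝ} (hf : IsBddLip f C) : 0 ≤ C :=
  (abs_nonneg _).trans (hf.bdd 0)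

theorem of_lipschitz {f : E → ℝ} (hf : Continuous f) {M L : ℝ} (hL : 0 ≤ L)
    (hM : ∀ x, |f x| ≤ M) (h : ∀ x u, |f (x + u) - f x| ≤ L * ‖u‖) :
    IsBddLip f (2 * M + L) := by
  have h0 : 0 ≤ M := (abs_nonneg _).trans (hM 0)
  refine ⟨hf, fun x => (hM x).trans (by linarith), fun x u => ?_⟩
  rcases le_total 1 ‖u‖ with hu | hu
  · rw [min_eq_left hu]
    have := abs_sub (f (x + u)) (f x)
    linarith [hM (x + u), hM x]
  · rw [min_eq_right hu]
    nlinarith [h x u, norm_nonneg u]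

theorem add_mul {f g : E → ℝ} {C D : ℝ} (hf : IsBddLip f C) (hg : IsBddLip g D) (t : ℝ) :
    IsBddLip (fun x => f x + t * g x) (C + |t| * D) := by
  refine ⟨hf.cont.add (continuous_const.mul hg.cont), fun x => ?_, fun x u => ?_⟩
  · refine (abs_add_le _ _).trans (add_le_add (hf.bdd x) ?_)
    rw [abs_mul]
    exact mul_le_mul_of_nonneg_left (hg.bdd x) (abs_nonneg t)
  · have e : f (x + u) + t * g (x + u) - (f x + t * g x) =
        (f (x + u) - f x) + t * (g (x + u) - g x) := by ring
    rw [e, _root_.add_mul, mul_assoc]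
    refine (abs_add_le _ _).trans (add_le_add (hf.incr x u) ?_)
    rw [abs_mul]
    exact mul_le_mul_of_nonneg_left (hg.incr x u) (abs_nonneg t)

end IsBddLip

theorem isBddLip_truncCoord {d : ℕ} {R : ℝ} (hR : 0 < R) (j : Fin d) :
    IsBddLip (truncCoord R j) (2 * R + 4) :=
  .of_lipschitz (continuous_truncCoord R j) (by norm_num) (abs_truncCoord_le hR j) fun x u => by
    simpa using abs_truncCoord_sub_le hR j x (x + u)

theorem isBddLip_comp_inner {E : Type*} [NormedAddCommGroup E] [InnerProductSpace ℝ E] (ξ : E)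
    {k : ℝ → ℝ} (hc : Continuous k) (hb : ∀ y, |k y| ≤ 1) (hk : ∀ y z, |k y - k z| ≤ |y - z|) :
    IsBddLip (fun x => k (inner ℝ ξ x)) (2 * 1 + ‖ξ‖) :=
  .of_lipschitz (by fun_prop) (norm_nonneg ξ) (fun x => hb _) fun x u => by
    refine (hk _ _).trans ?_
    rw [inner_add_right, add_sub_cancel_left]
    exact norm_inner_le_norm (𝕜 := ℝ) ξ u

theorem integral_add_mul_add_mul {X : Type*} [MeasurableSpace X] {μ : Measure X} {a b c : X → ℝ}
    (ha : Integrable a μ) (hb : Integrable b μ) (hc : Integrable c μ) (r s : ℝ) :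
    ∫ x, (a x + (r * b x + s * c x)) ∂μ = ∫ x, a x ∂μ + (r * ∫ x, b x ∂μ + s * ∫ x, c x ∂μ) := by
  rw [← integral_const_mul, ← integral_const_mul, ← integral_add (hb.const_mul r) (hc.const_mul s)]
  exact integral_add ha ((hb.const_mul r).add (hc.const_mul s))

/-! ### Energy, Poincaré inequality and the deficit form. -/

section energy

variable {d : ℕ} {α : ℝ} {μ : Measure (EuclideanSpace ℝ (Fin d))} [IsProbabilityMeasure μ]

/-- The increment `f (x + u) - f x` as a function of the pair `(x, u)`. -/
def increment {E : Type*} [Add E] (f : E → ℝ) (p : E × E) : ℝ := f (p.1 + p.2) - f p.1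

theorem continuous_increment {E : Type*} [NormedAddCommGroup E] {f : E → ℝ} (hf : Continuous f) :
    Continuous (increment f) := by
  unfold increment; fun_prop

theorem integrable_prod_of_bound (hd : 1 ≤ d) (h1 : 1 < α) (h2 : α < 2)
    {F : EuclideanSpace ℝ (Fin d) × EuclideanSpace ℝ (Fin d) → ℝ} (hF : Continuous F) {C : ℝ}
    (hC : ∀ p, |F p| ≤ C * (‖p.2‖ * min 1 ‖p.2‖)) :
    Integrable F (μ.prod (stableLevyMeasure d α)) :=
  (((integrable_stable_weight hd h1 h2).comp_snd μ).const_mul C).mono'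
    hF.aestronglyMeasurable (ae_of_all _ hC)

theorem integrable_increment_mul (hd : 1 ≤ d) (h1 : 1 < α) (h2 : α < 2)
    {f g : EuclideanSpace ℝ (Fin d) → ℝ} {C D : ℝ} (hf : IsBddLip f C) (hg : IsBddLip g D) :
    Integrable (fun p => increment f p * increment g p) (μ.prod (stableLevyMeasure d α)) := by
  refine integrable_prod_of_bound hd h1 h2 (C := C * D)
    ((continuous_increment hf.cont).mul (continuous_increment hg.cont)) fun p => ?_
  rw [abs_mul]
  have h0 : 0 ≤ min 1 ‖p.2‖ := by positivity
  calc |increment f p| * |increment g p|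
      ≤ (C * min 1 ‖p.2‖) * (D * min 1 ‖p.2‖) :=
        mul_le_mul (hf.incr _ _) (hg.incr _ _) (abs_nonneg _) (mul_nonneg hf.nonneg h0)
    _ = C * D * (min 1 ‖p.2‖ * min 1 ‖p.2‖) := by ring
    _ ≤ _ := by
      gcongr
      · exact mul_nonneg hf.nonneg hg.nonneg
      · exact min_le_right _ _

theorem integrable_mul_bddLip {f g : EuclideanSpace ℝ (Fin d) → ℝ} {C D : ℝ}
    (hf : IsBddLip f C) (hg : IsBddLip g D) : Integrable (fun x => f x * g x) μ :=
  .of_bound (hf.cont.mul hg.cont).aestronglyMeasurable (C * D) <| ae_of_all _ fun x => by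
    rw [norm_mul]
    exact mul_le_mul (hf.bdd x) (hg.bdd x) (abs_nonneg _) hf.nonneg

theorem IsBddLip.integrable {f : EuclideanSpace ℝ (Fin d) → ℝ} {C : ℝ}
    (hf : IsBddLip f C) : Integrable f μ :=
  .of_bound hf.cont.aestronglyMeasurable C (ae_of_all _ hf.bdd)

theorem IsBddLip.memLp {f : EuclideanSpace ℝ (Fin d) → ℝ} {C : ℝ}
    (hf : IsBddLip f C) : MemLp f 2 μ :=
  .of_bound hf.cont.aestronglyMeasurable C (ae_of_all _ hf.bdd)

theorem stableEnergy_eq (hd : 1 ≤ d) (h1 : 1 < α) (h2 : α < 2)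
    {f : EuclideanSpace ℝ (Fin d) → ℝ} {C : ℝ} (hf : IsBddLip f C) :
    stableEnergy α μ f =
      ENNReal.ofReal (∫ p, increment f p * increment f p ∂(μ.prod (stableLevyMeasure d α))) := by
  rw [ofReal_integral_eq_lintegral_ofReal (integrable_increment_mul hd h1 h2 hf hf)
    (ae_of_all _ fun p => mul_self_nonneg _), lintegral_prod _ (by
      have := continuous_increment hf.cont
      exact (ENNReal.measurable_ofReal.comp (this.mul this).measurable).aemeasurable)]
  unfold stableEnergy increment
  simp_rw [sq_abs, sq]

theorem volume_absolutelyContinuous_stableLevyMeasure (hd : 1 ≤ d) (h1 : 1 < α) (h2 : α < 2) :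
    (volume : Measure (EuclideanSpace ℝ (Fin d))) ≪ stableLevyMeasure d α := by
  have : Nonempty (Fin d) := ⟨⟨0, hd⟩⟩
  refine withDensity_absolutelyContinuous' (measurable_stableDensity d α).aemeasurable ?_
  filter_upwards [Measure.ae_ne volume (0 : EuclideanSpace ℝ (Fin d))] with u hu
  have hu : 0 < ‖u‖ := norm_pos_iff.2 hu
  have := stableConst_pos d h1 h2
  exact (ENNReal.ofReal_pos.2 (by positivity)).ne'

/-- Functions of zero energy are excluded from the supremum, so the Poincaré inequality needs them
treated apart. For one `x` the increments vanish `ν_α`-a.e., hence Lebesgue-a.e. since the density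
is positive off the origin, hence everywhere by continuity. -/
theorem eq_const_of_stableEnergy_eq_zero (hd : 1 ≤ d) (h1 : 1 < α) (h2 : α < 2)
    {f : EuclideanSpace ℝ (Fin d) → ℝ} {C : ℝ} (hf : IsBddLip f C)
    (h : stableEnergy α μ f = 0) : ∃ c, f = fun _ => c := by
  rw [stableEnergy_eq hd h1 h2 hf, ENNReal.ofReal_eq_zero] at h
  have h0 := le_antisymm h (integral_nonneg fun p => mul_self_nonneg _)
  rw [integral_eq_zero_iff_of_nonneg (fun p => mul_self_nonneg _)
    (integrable_increment_mul hd h1 h2 hf hf)] at h0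
  obtain ⟨x, hx⟩ := (Measure.ae_ae_of_ae_prod h0).exists
  have hx' := (volume_absolutelyContinuous_stableLevyMeasure hd h1 h2).ae_le hx
  have : (fun u => f (x + u)) =ᵐ[volume] fun _ => f x := by
    filter_upwards [hx'] with u hu
    simpa [increment, sub_eq_zero] using hu
  have := (Continuous.ae_eq_iff_eq volume (hf.cont.comp (continuous_const.add continuous_id))
    continuous_const).1 this
  refine ⟨f x, funext fun y => ?_⟩
  simpa using congrFun this (y - x)

/-- The Poincaré inequality in real form, for bounded Lipschitz functions. -/
theorem variance_le_of_poincareU_le_one (hd : 1 ≤ d) (h1 : 1 < α) (h2 : α < 2)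
    (hU : poincareU α μ ≤ 1) {f : EuclideanSpace ℝ (Fin d) → ℝ} {C : ℝ} (hf : IsBddLip f C) :
    variance f μ ≤
      ∫ p, increment f p * increment f p ∂(μ.prod (stableLevyMeasure d α)) := by
  have hnn : 0 ≤ ∫ p, increment f p * increment f p ∂(μ.prod (stableLevyMeasure d α)) :=
    integral_nonneg fun p => mul_self_nonneg _
  have hE := stableEnergy_eq (μ := μ) hd h1 h2 hf
  rcases eq_or_ne (stableEnergy α μ f) 0 with h | h
  · obtain ⟨c, rfl⟩ := eq_const_of_stableEnergy_eq_zero hd h1 h2 hf h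
    rw [variance_eq_sub hf.memLp]
    simpa using hnn
  · have hfin : stableEnergy α μ f < ∞ := by rw [hE]; exact ENNReal.ofReal_lt_top
    have hmem : f ∈ stableTestFunctions α μ :=
      ⟨hf.cont.measurable, (evariance_lt_top_iff_memLp hf.cont.aestronglyMeasurable).2 hf.memLp,
        pos_iff_ne_zero.2 h, hfin⟩
    have hle : evariance f μ / stableEnergy α μ f ≤ 1 :=
      (le_iSup₂ (f := fun f (_ : f ∈ stableTestFunctions α μ) =>
        evariance f μ / stableEnergy α μ f) f hmem).trans hU
    rw [ENNReal.div_le_iff h hfin.ne, one_mul, ← ofReal_variance hf.memLp, hE,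
      ENNReal.ofReal_le_ofReal_iff hnn] at hle
    exact hle

/-- The bilinear form `𝓔(f, g) - Cov(f, g)`. -/
noncomputable def deficit (α : ℝ) (μ : Measure (EuclideanSpace ℝ (Fin d)))
    (f g : EuclideanSpace ℝ (Fin d) → ℝ) : ℝ :=
  ∫ p, increment f p * increment g p ∂(μ.prod (stableLevyMeasure d α)) -
    (∫ x, f x * g x ∂μ - (∫ x, f x ∂μ) * ∫ x, g x ∂μ)

theorem deficit_self {f : EuclideanSpace ℝ (Fin d) → ℝ} {C : ℝ} (hf : IsBddLip f C) :
    deficit α μ f f =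
      ∫ p, increment f p * increment f p ∂(μ.prod (stableLevyMeasure d α)) - variance f μ := by
  rw [variance_eq_sub hf.memLp]
  simp [deficit, sq]

theorem deficit_add_mul_self (hd : 1 ≤ d) (h1 : 1 < α) (h2 : α < 2)
    {f g : EuclideanSpace ℝ (Fin d) → ℝ} {C D : ℝ} (hf : IsBddLip f C) (hg : IsBddLip g D)
    (t : ℝ) :
    deficit α μ (fun x => f x + t * g x) (fun x => f x + t * g x) =
      deficit α μ g g * (t * t) + 2 * deficit α μ f g * t + deficit α μ f f := by
  have e1 : ∀ p, increment (fun x => f x + t * g x) p * increment (fun x => f x + t * g x) p =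
      increment f p * increment f p + ((2 * t) * (increment f p * increment g p) +
        (t * t) * (increment g p * increment g p)) := by
    intro p; simp only [increment]; ring
  have e2 : ∀ x, (f x + t * g x) * (f x + t * g x) =
      f x * f x + ((2 * t) * (f x * g x) + (t * t) * (g x * g x)) := by intro x; ring
  have i1 := integrable_increment_mul (μ := μ) hd h1 h2 hf hf
  have i2 := integrable_increment_mul (μ := μ) hd h1 h2 hf hg
  have i3 := integrable_increment_mul (μ := μ) hd h1 h2 hg hg
  have j1 := integrable_mul_bddLip (μ := μ) hf hf
  have j2 := integrable_mul_bddLip (μ := μ) hf hg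
  have j3 := integrable_mul_bddLip (μ := μ) hg hg
  unfold deficit
  simp_rw [e1, e2]
  rw [integral_add_mul_add_mul i1 i2 i3, integral_add_mul_add_mul j1 j2 j3,
    integral_add hf.integrable (hg.integrable.const_mul _), integral_const_mul]
  ring

/-- Cauchy–Schwarz: `t ↦ D(f + t g, f + t g)` is a nonnegative quadratic polynomial, so its
discriminant is at most `0`. -/
theorem deficit_sq_le (hd : 1 ≤ d) (h1 : 1 < α) (h2 : α < 2) (hU : poincareU α μ ≤ 1)
    {f g : EuclideanSpace ℝ (Fin d) → ℝ} {C D : ℝ} (hf : IsBddLip f C) (hg : IsBddLip g D) :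
    deficit α μ f g ^ 2 ≤ deficit α μ g g * deficit α μ f f := by
  have h : ∀ t : ℝ, 0 ≤ deficit α μ g g * (t * t) + 2 * deficit α μ f g * t + deficit α μ f f := by
    intro t
    rw [← deficit_add_mul_self hd h1 h2 hf hg t, deficit_self (hf.add_mul hg t), sub_nonneg]
    exact variance_le_of_poincareU_le_one hd h1 h2 hU (hf.add_mul hg t)
  have := discrim_le_zero h
  rw [discrim] at this
  linarith

end energy

/-! ### The Euler–Lagrange identity and trigonometric test functions. -/

section identity

variable {d : ℕ} {α : ℝ} {μ : Measure (EuclideanSpace ℝ (Fin d))}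

theorem tendsto_integral_truncCoord_mul
    (hint : Integrable (fun x : EuclideanSpace ℝ (Fin d) => x) μ)
    {h : EuclideanSpace ℝ (Fin d) → ℝ} (hc : Continuous h) {C : ℝ} (hb : ∀ x, |h x| ≤ C)
    (j : Fin d) :
    Tendsto (fun R : ℝ => ∫ x, truncCoord R j x * h x ∂μ) atTop (𝓝 (∫ x, x j * h x ∂μ)) := by
  refine tendsto_integral_filter_of_dominated_convergence (fun x => ‖x‖ * C)
    (Eventually.of_forall fun R => ((continuous_truncCoord R j).mul hc).aestronglyMeasurable)
    (Eventually.of_forall fun R => ae_of_all _ fun x => ?_) (hint.norm.mul_const C)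
    (ae_of_all _ fun x => (tendsto_truncCoord j x).mul_const _)
  rw [norm_mul]
  exact mul_le_mul (abs_truncCoord_le_norm R j x) (hb x) (abs_nonneg _) (norm_nonneg _)

theorem integral_inner_eq_zero (hint : Integrable (fun x : EuclideanSpace ℝ (Fin d) => x) μ)
    (hcent : ∫ x, x ∂μ = 0) (ξ : EuclideanSpace ℝ (Fin d)) : ∫ x, inner ℝ ξ x ∂μ = 0 := by
  have := integral_inner (𝕜 := ℝ) hint ξ
  rwa [hcent, inner_zero_right] at this

theorem integrable_coord_mul (hint : Integrable (fun x : EuclideanSpace ℝ (Fin d) => x) μ)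
    {h : EuclideanSpace ℝ (Fin d) → ℝ} {C : ℝ} (hh : IsBddLip h C) (j : Fin d) :
    Integrable (fun x => x j * h x) μ := by
  refine (hint.norm.mul_const C).mono'
    (Continuous.aestronglyMeasurable (by have := hh.cont; fun_prop)) (ae_of_all _ fun x => ?_)
  rw [norm_mul]
  exact mul_le_mul (abs_coord_le_norm x j) (hh.bdd x) (abs_nonneg _) (norm_nonneg _)

variable [IsProbabilityMeasure μ]

theorem tendsto_integral_increment_truncCoord_mul (hd : 1 ≤ d) (h1 : 1 < α) (h2 : α < 2)
    {h : EuclideanSpace ℝ (Fin d) → ℝ} {C : ℝ} (hh : IsBddLip h C) (j : Fin d) :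
    Tendsto (fun R : ℝ => ∫ p, increment (truncCoord R j) p * increment h p
        ∂(μ.prod (stableLevyMeasure d α)))
      atTop (𝓝 (∫ p, p.2 j * increment h p ∂(μ.prod (stableLevyMeasure d α)))) := by
  refine tendsto_integral_filter_of_dominated_convergence
    (fun p => (4 * C) * (‖p.2‖ * min 1 ‖p.2‖))
    (Eventually.of_forall fun R => ((continuous_increment (continuous_truncCoord R j)).mul
      (continuous_increment hh.cont)).aestronglyMeasurable)
    ?_ (((integrable_stable_weight hd h1 h2).comp_snd μ).const_mul _) (ae_of_all _ fun p => ?_)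
  · filter_upwards [eventually_gt_atTop 0] with R hR
    refine ae_of_all _ fun p => ?_
    rw [norm_mul]
    have e1 : |increment (truncCoord R j) p| ≤ 4 * ‖p.2‖ := by
      simpa [increment] using abs_truncCoord_sub_le hR j p.1 (p.1 + p.2)
    have e2 : |increment h p| ≤ C * min 1 ‖p.2‖ := hh.incr _ _
    refine (mul_le_mul e1 e2 (abs_nonneg _) (by positivity)).trans_eq (by ring)
  · refine Tendsto.mul_const _ ?_
    have := (tendsto_truncCoord j (p.1 + p.2)).sub (tendsto_truncCoord j p.1)
    simpa [increment] using this

theorem integrable_coord_mul_increment (hd : 1 ≤ d) (h1 : 1 < α) (h2 : α < 2)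
    {h : EuclideanSpace ℝ (Fin d) → ℝ} {C : ℝ} (hh : IsBddLip h C) (j : Fin d) :
    Integrable (fun p => p.2 j * increment h p) (μ.prod (stableLevyMeasure d α)) := by
  refine integrable_prod_of_bound hd h1 h2 (C := C)
    (by have := continuous_increment hh.cont; fun_prop) fun p => ?_
  rw [abs_mul]
  have e2 : |increment h p| ≤ C * min 1 ‖p.2‖ := hh.incr _ _
  exact (mul_le_mul (abs_coord_le_norm p.2 j) e2 (abs_nonneg _) (norm_nonneg _)).trans_eq (by ring)

/-- The Euler–Lagrange equation satisfied by an extremal measure. -/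
theorem integral_coord_mul_eq (hd : 1 ≤ d) (h1 : 1 < α) (h2 : α < 2)
    (hint : Integrable (fun x : EuclideanSpace ℝ (Fin d) => x) μ) (hcent : ∫ x, x ∂μ = 0)
    (hU : poincareU α μ ≤ 1) (j : Fin d)
    (hlim : Tendsto
      (fun R : ℝ => variance (truncCoord R j) μ - (stableEnergy α μ (truncCoord R j)).toReal)
      atTop (𝓝 0))
    {h : EuclideanSpace ℝ (Fin d) → ℝ} {C : ℝ} (hh : IsBddLip h C) :
    ∫ x, x j * h x ∂μ = ∫ p, p.2 j * increment h p ∂(μ.prod (stableLevyMeasure d α)) := by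
  have hz : ∫ x, x j ∂μ = 0 := by
    simpa [EuclideanSpace.inner_single_left] using
      integral_inner_eq_zero hint hcent (EuclideanSpace.single j (1 : ℝ))
  have t1 := tendsto_integral_truncCoord_mul hint hh.cont hh.bdd j
  -- The means of the truncated coordinates tend to `0` by centering, so the product of means in the
  -- covariance disappears in the limit.
  have t2 := tendsto_integral_truncCoord_mul hint (h := fun _ => 1) continuous_const (C := 1)
    (by simp) j
  simp only [mul_one, hz] at t2
  have t3 := tendsto_integral_increment_truncCoord_mul (μ := μ) hd h1 h2 hh j
  have t4 : Tendsto (fun R : ℝ => deficit α μ (truncCoord R j) h) atTop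
      (𝓝 (∫ p, p.2 j * increment h p ∂(μ.prod (stableLevyMeasure d α)) -
        (∫ x, x j * h x ∂μ - 0 * ∫ x, h x ∂μ))) :=
    t3.sub (t1.sub (t2.mul_const _))
  have t5 : Tendsto (fun R : ℝ => deficit α μ (truncCoord R j) (truncCoord R j)) atTop (𝓝 0) := by
    have := hlim.neg
    rw [neg_zero] at this
    refine this.congr' ?_
    filter_upwards [eventually_gt_atTop 0] with R hR
    rw [deficit_self (isBddLip_truncCoord hR j),
      stableEnergy_eq hd h1 h2 (isBddLip_truncCoord hR j),
      ENNReal.toReal_ofReal (integral_nonneg fun p => mul_self_nonneg _), neg_sub]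
  -- Squeeze by Cauchy–Schwarz: `D(h,h)` is fixed while `D(g_R,g_R) → 0`. Comparison with `t4` then
  -- shows that the limit found there is `0`.
  have t6 : Tendsto (fun R : ℝ => deficit α μ (truncCoord R j) h ^ 2) atTop (𝓝 0) := by
    refine tendsto_of_tendsto_of_tendsto_of_le_of_le' tendsto_const_nhds
      (by simpa using t5.const_mul (deficit α μ h h))
      (Eventually.of_forall fun R => sq_nonneg _) ?_
    filter_upwards [eventually_gt_atTop 0] with R hR
    exact deficit_sq_le hd h1 h2 hU (isBddLip_truncCoord hR j) hh
  have := tendsto_nhds_unique (t4.pow 2) t6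
  have := pow_eq_zero_iff (two_ne_zero) |>.1 this
  linarith

theorem integral_inner_mul_eq (hd : 1 ≤ d) (h1 : 1 < α) (h2 : α < 2)
    (hint : Integrable (fun x : EuclideanSpace ℝ (Fin d) => x) μ) (hcent : ∫ x, x ∂μ = 0)
    (hU : poincareU α μ ≤ 1)
    (hlim : ∀ j : Fin d, Tendsto
      (fun R : ℝ => variance (truncCoord R j) μ - (stableEnergy α μ (truncCoord R j)).toReal)
      atTop (𝓝 0))
    {h : EuclideanSpace ℝ (Fin d) → ℝ} {C : ℝ} (hh : IsBddLip h C)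
    (ξ : EuclideanSpace ℝ (Fin d)) :
    ∫ x, inner ℝ ξ x * h x ∂μ =
      ∫ p, inner ℝ ξ p.2 * increment h p ∂(μ.prod (stableLevyMeasure d α)) := by
  have e : ∀ (x : EuclideanSpace ℝ (Fin d)) (c : ℝ),
      inner ℝ ξ x * c = ∑ j, ξ j * (x j * c) := by
    intro x c
    rw [PiLp.inner_apply, Finset.sum_mul]
    refine Finset.sum_congr rfl fun j _ => ?_
    simp only [RCLike.inner_apply, conj_trivial]
    ring
  simp_rw [e]
  rw [integral_finsetSum _ fun j _ => (integrable_coord_mul hint hh j).const_mul _,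
    integral_finsetSum _ fun j _ => (integrable_coord_mul_increment hd h1 h2 hh j).const_mul _]
  refine Finset.sum_congr rfl fun j _ => ?_
  rw [integral_const_mul, integral_const_mul,
    integral_coord_mul_eq hd h1 h2 hint hcent hU j (hlim j) hh]

theorem abs_cos_sub_one_le_min (y : ℝ) : |Real.cos y - 1| ≤ 2 * min 1 |y| := by
  have h : |Real.cos y - 1| ≤ |y| := by simpa using Real.abs_cos_sub_cos_le y 0
  rcases le_total 1 |y| with hy | hy
  · rw [min_eq_left hy, abs_le]
    constructor <;> linarith [Real.cos_le_one y, Real.neg_one_le_cos y]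
  · rw [min_eq_right hy]
    linarith [abs_nonneg y]

theorem integrable_inner_mul_cos_sub_one_stable (hd : 1 ≤ d) (h1 : 1 < α) (h2 : α < 2)
    (ξ : EuclideanSpace ℝ (Fin d)) :
    Integrable (fun u => inner ℝ ξ u * (Real.cos (inner ℝ ξ u) - 1)) (stableLevyMeasure d α) := by
  refine integrable_stable_of_bound hd h1 h2 (C := ‖ξ‖ * (2 * (1 + ‖ξ‖))) (by fun_prop) fun u => ?_
  have hb : |inner ℝ ξ u| ≤ ‖ξ‖ * ‖u‖ := norm_inner_le_norm (𝕜 := ℝ) ξ u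
  rw [abs_mul]
  calc |inner ℝ ξ u| * |Real.cos (inner ℝ ξ u) - 1|
      ≤ (‖ξ‖ * ‖u‖) * (2 * ((1 + ‖ξ‖) * min 1 ‖u‖)) := by
        refine mul_le_mul hb ?_ (abs_nonneg _) (by positivity)
        refine (abs_cos_sub_one_le_min _).trans ?_
        gcongr
        exact (min_le_min_left 1 hb).trans (min_one_mul_le (norm_nonneg _) (norm_nonneg _))
    _ = _ := by ring

/-- The integrand is odd and the Lévy measure is symmetric. -/
theorem integral_inner_mul_cos_sub_one_stable (ξ : EuclideanSpace ℝ (Fin d)) :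
    ∫ u, inner ℝ ξ u * (Real.cos (inner ℝ ξ u) - 1) ∂(stableLevyMeasure d α) = 0 := by
  have := integral_neg_eq_self (fun u : EuclideanSpace ℝ (Fin d) =>
    inner ℝ ξ u * (Real.cos (inner ℝ ξ u) - 1)) (stableLevyMeasure d α)
  simp only [inner_neg_right, Real.cos_neg, neg_mul, integral_neg] at this
  linarith

theorem isBddLip_cos_inner (ξ : EuclideanSpace ℝ (Fin d)) :
    IsBddLip (fun x => Real.cos (inner ℝ ξ x)) (2 * 1 + ‖ξ‖) :=
  isBddLip_comp_inner ξ Real.continuous_cos Real.abs_cos_le_one Real.abs_cos_sub_cos_le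

theorem isBddLip_sin_inner (ξ : EuclideanSpace ℝ (Fin d)) :
    IsBddLip (fun x => Real.sin (inner ℝ ξ x)) (2 * 1 + ‖ξ‖) :=
  isBddLip_comp_inner ξ Real.continuous_sin Real.abs_sin_le_one Real.abs_sin_sub_sin_le

/-- A common form for the sine and cosine addition formulas: `(k, l)` is `(cos, -sin)` for `h = cos`
and `(sin, cos)` for `h = sin`. Only the `l` term survives integration in `u`. -/
theorem integral_inner_mul_increment_of_addition (hd : 1 ≤ d) (h1 : 1 < α) (h2 : α < 2)
    {h k l : EuclideanSpace ℝ (Fin d) → ℝ} (hk : Integrable k μ) (hl : Integrable l μ)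
    (ξ : EuclideanSpace ℝ (Fin d))
    (hadd : ∀ x u, h (x + u) - h x =
      k x * (Real.cos (inner ℝ ξ u) - 1) + l x * Real.sin (inner ℝ ξ u)) :
    ∫ p, inner ℝ ξ p.2 * increment h p ∂(μ.prod (stableLevyMeasure d α)) =
      (∫ x, l x ∂μ) * (α / 2 * ‖ξ‖ ^ α) := by
  have e : ∀ p : EuclideanSpace ℝ (Fin d) × EuclideanSpace ℝ (Fin d),
      inner ℝ ξ p.2 * increment h p =
      k p.1 * (inner ℝ ξ p.2 * (Real.cos (inner ℝ ξ p.2) - 1)) +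
        l p.1 * (inner ℝ ξ p.2 * Real.sin (inner ℝ ξ p.2)) := by
    intro p; rw [increment, hadd]; ring
  simp_rw [e]
  rw [integral_add
    (hk.mul_prod (integrable_inner_mul_cos_sub_one_stable hd h1 h2 ξ))
    (hl.mul_prod (integrable_inner_mul_sin_stable hd h1 h2 ξ)),
    integral_prod_mul k (fun u => inner ℝ ξ u * (Real.cos (inner ℝ ξ u) - 1)),
    integral_prod_mul l (fun u => inner ℝ ξ u * Real.sin (inner ℝ ξ u)),
    integral_inner_mul_cos_sub_one_stable, integral_inner_mul_sin_stable hd h1 h2, mul_zero,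
    zero_add]

end identity

/-! ### The radial equation and the conclusion. -/

/-- The radial differential equation and its solution. -/
theorem eq_exp_of_hasDerivAt {Φ Φ' : ℝ → ℂ} {α a : ℝ} (h1 : 1 < α)
    (hΦ : ∀ t, HasDerivAt Φ (Φ' t) t) (h0 : Φ' 0 = 0)
    (heq : ∀ t, 0 < t → t * Φ' t = -((α / 2 * (t ^ α * a) : ℝ) : ℂ) * Φ t) :
    Φ 1 = Φ 0 * ((Real.exp (-a / 2) : ℝ) : ℂ) := by
  -- The integrating factor `exp(t^α a/2)` makes the product constant on `[0, 1]`.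
  have hder : ∀ t, HasDerivAt (fun t : ℝ => Φ t * ((Real.exp (t ^ α * (a / 2)) : ℝ) : ℂ))
      (Φ' t * ((Real.exp (t ^ α * (a / 2)) : ℝ) : ℂ) +
        Φ t * ((Real.exp (t ^ α * (a / 2)) * (α * t ^ (α - 1) * (a / 2)) : ℝ) : ℂ)) t := by
    intro t
    refine (hΦ t).mul (HasDerivAt.ofReal_comp (HasDerivAt.exp ?_))
    exact (Real.hasDerivAt_rpow_const (Or.inr h1.le)).mul_const _
  have hc := constant_of_has_deriv_right_zero (a := 0) (b := 1)
    (f := fun t : ℝ => Φ t * ((Real.exp (t ^ α * (a / 2)) : ℝ) : ℂ))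
    (fun t _ => (hder t).continuousAt.continuousWithinAt) (by
      intro t ht
      convert (hder t).hasDerivWithinAt using 1
      -- The equation carries a factor `t` and says nothing at `0`; there `Φ' 0 = 0` is used,
      -- together with `0^(α-1) = 0`, valid as `α > 1`.
      rcases ht.1.eq_or_lt with rfl | ht0
      · rw [h0, Real.zero_rpow (by linarith : α - 1 ≠ 0)]
        simp
      · have ht' : (t : ℂ) ≠ 0 := by exact_mod_cast ht0.ne'
        apply mul_left_cancel₀ ht'
        have e : t ^ α = t ^ (α - 1) * t := by
          rw [← Real.rpow_add_one ht0.ne']; ring_nf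
        have hq := heq t ht0
        set E := Real.exp (t ^ α * (a / 2))
        rw [e] at hq
        push_cast at hq ⊢
        linear_combination -(E : ℂ) * hq)
    1 (by simp)
  simp only [Real.one_rpow, one_mul, Real.zero_rpow (by linarith : α ≠ 0), zero_mul,
    Real.exp_zero, Complex.ofReal_one, mul_one] at hc
  rw [← hc, mul_assoc, ← Complex.ofReal_mul, ← Real.exp_add]
  rw [show a / 2 + -a / 2 = 0 by ring]; simp

theorem charFun_eq_of_poincareU_le_one {d : ℕ} (hd : 1 ≤ d) {α : ℝ} (h1 : 1 < α) (h2 : α < 2)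
    {μ : Measure (EuclideanSpace ℝ (Fin d))} [IsProbabilityMeasure μ]
    (hint : Integrable (fun x : EuclideanSpace ℝ (Fin d) => x) μ)
    (hcent : ∫ x, x ∂μ = 0)
    (hlim : ∀ j : Fin d, Tendsto
      (fun R : ℝ => variance (truncCoord R j) μ - (stableEnergy α μ (truncCoord R j)).toReal)
      atTop (𝓝 0))
    (hU : poincareU α μ ≤ 1) (ξ : EuclideanSpace ℝ (Fin d)) :
    charFun μ ξ = ((Real.exp (-(‖ξ‖ ^ α) / 2) : ℝ) : ℂ) := by
  have hder := hasDerivAt_integral_exp_inner (μ := μ) (w := fun _ => 1)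
    (integrable_const 1) (by simpa using hint.norm) ξ
  simp only [one_mul] at hder
  have hmain := eq_exp_of_hasDerivAt (a := ‖ξ‖ ^ α) h1 hder ?_ ?_
  · rw [charFun_apply]
    simpa [real_inner_comm] using hmain
  -- The derivative at `0` is `i` times the mean of `⟨ξ, X⟩`, which vanishes by centering.
  · simp only [zero_mul, Complex.ofReal_zero, Complex.exp_zero, one_mul]
    rw [integral_mul_const, integral_complex_ofReal, integral_inner_eq_zero hint hcent]
    simp
  · intro t ht
    set η := t • ξ with hη
    have hnorm : t ^ α * ‖ξ‖ ^ α = ‖η‖ ^ α := by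
      rw [hη, norm_smul, Real.norm_of_nonneg ht.le, Real.mul_rpow ht.le (norm_nonneg _)]
    have hin : ∀ x, t * inner ℝ ξ x = inner ℝ η x := fun x => by rw [hη, real_inner_smul_left]
    have hc := isBddLip_cos_inner η
    have hs := isBddLip_sin_inner η
    have ic := integral_inner_mul_eq hd h1 h2 hint hcent hU hlim hc η
    have is := integral_inner_mul_eq hd h1 h2 hint hcent hU hlim hs η
    rw [integral_inner_mul_increment_of_addition hd h1 h2 hc.integrable
      hs.integrable.fun_neg η
      (l := fun x => -Real.sin (inner ℝ η x))
      (fun x u => by rw [inner_add_right, Real.cos_add]; ring), integral_neg] at ic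
    rw [integral_inner_mul_increment_of_addition hd h1 h2 hs.integrable hc.integrable η
      (fun x u => by rw [inner_add_right, Real.sin_add]; ring)] at is
    rw [hnorm, ← integral_const_mul]
    simp_rw [hin]
    -- The factor `t` turns `⟨ξ, x⟩` into `⟨η, x⟩`, so that the real and imaginary parts of `t
    -- Φ'(t)` are the left sides of `ic`, up to sign on the real part, as follows: the real part is
    -- minus the left side of `is`, the imaginary part is the left side of `ic`.
    have e1 : ∀ x, (t : ℂ) * (Complex.exp ((inner ℝ η x : ℝ) * Complex.I) *
        ((inner ℝ ξ x : ℝ) * Complex.I)) =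
        ((-(inner ℝ η x * Real.sin (inner ℝ η x)) : ℝ) : ℂ) +
          ((inner ℝ η x * Real.cos (inner ℝ η x) : ℝ) : ℂ) * Complex.I := by
      intro x
      rw [Complex.exp_mul_I, ← hin]
      push_cast
      linear_combination (t : ℂ) * Complex.sin (t * inner ℝ ξ x) * inner ℝ ξ x * Complex.I_mul_I
    have e2 : ∀ x, Complex.exp ((inner ℝ η x : ℝ) * Complex.I) =
        ((Real.cos (inner ℝ η x) : ℝ) : ℂ) + ((Real.sin (inner ℝ η x) : ℝ) : ℂ) * Complex.I := by
      intro x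
      rw [Complex.exp_mul_I]; push_cast; rfl
    have hb : ∀ {k : EuclideanSpace ℝ (Fin d) → ℝ} {C : ℝ}, IsBddLip k C →
        Integrable (fun x => inner ℝ η x * k x) μ := by
      intro k C hk
      refine (hint.norm.const_mul (‖η‖ * C)).mono'
        (Continuous.aestronglyMeasurable (by have := hk.cont; fun_prop)) (ae_of_all _ fun x => ?_)
      rw [norm_mul]
      exact (mul_le_mul (norm_inner_le_norm (𝕜 := ℝ) η x) (hk.bdd x) (abs_nonneg _)
        (by positivity)).trans_eq (by ring)
    simp_rw [e1, e2]
    rw [integral_add (hb hs).neg.ofReal ((hb hc).ofReal.mul_const _),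
      integral_add hc.integrable.ofReal (hs.integrable.ofReal.mul_const _),
      integral_mul_const, integral_mul_const, integral_complex_ofReal, integral_complex_ofReal, integral_complex_ofReal,
      integral_complex_ofReal, integral_neg, ic, is]
    push_cast
    ring

theorem mainTheorem10 {d : ℕ} (hd : 1 ≤ d) (α : ℝ) (hα1 : 1 < α) (hα2 : α < 2)
    (μ : Measure (EuclideanSpace ℝ (Fin d))) [IsProbabilityMeasure μ]
    (hint : Integrable (fun x : EuclideanSpace ℝ (Fin d) => x) μ)
    (hcent : ∫ x, x ∂μ = 0)
    (hlim : ∀ j : Fin d, Tendsto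
      (fun R : ℝ => variance (truncCoord R j) μ - (stableEnergy α μ (truncCoord R j)).toReal)
      atTop (𝓝 0))
    (hU : poincareU α μ = 1) :
    IsRotInvStableLaw α μ ∧
      ∀ μα : Measure (EuclideanSpace ℝ (Fin d)), IsRotInvStableLaw α μα → μ = μα := by
  have h := charFun_eq_of_poincareU_le_one hd hα1 hα2 hint hcent hlim hU.le
  refine ⟨⟨inferInstance, h⟩, fun μα hμα => ?_⟩
  have := hμα.1
  exact Measure.ext_of_charFun (funext fun ξ => (h ξ).trans (hμα.2 ξ).symm)
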